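/- Let $k\ge 2$ be an integer and let $\mathbf{x}=(x(n))_{n\ge 0}$ and $\mathbf{y}=(y(n))_{n\ge 0}$ be $k$-automatic sequences, i.e. for each of them there is a finite deterministic automaton with output which, on reading the base-$k$ representation of $n$, ends in a state whose output is the $n$-th term. Let $\mathbb{N}_\infty=\mathbb{N}\cup\{\infty\}$ be the semiring of extended non-negative integers, with $a+\infty=\infty$, $a\cdot\infty=\infty$ for $a\neq 0$ and $0\cdot\infty=0$. A sequence $f:\mathbb{N}\to\mathbb{N}_\infty$ is $(\mathbb{N}_\infty,k)$-regular if there are $r\geq 0$, a row vector $u$, a column vector $v$ and a morphism $\mu$ from $\{0,\dots,k-1\}^*$ to the $r\times r$ matrices, all with entries in $\mathbb{N}_\infty$, such that $f([w]_k)=u\,\mu(w)\,v$ for every word $w\in\{0,\dots,k-1\}^*$, where $[w]_k$ is the integer that $w$ represents in base $k$ (most significant digit first, leading zeros allowed). Conventions. The factor $\mathbf{x}[i..i+l-1]=x(i)\cdots x(i+l-1)$ with $l\ge 1$ begins at position $i$ and ends at position $i+l-1$. It is centred at position $n$ if $n$ is its middle position; as a factor of even length has two middle positions, "centred at $n$"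 may be read in any one of the following ways (the same one for all $n$), and the assertions below hold for each of them: $n=i+\lfloor (l-1)/2\rfloor$; or $n=i+\lfloor l/2\rfloor$; or $l$ is odd and $n=i+(l-1)/2$. A square is a word $uu$ with $u$ nonempty; a palindrome is a nonempty word equal to its reversal; a fractional power with exponent $|w|/|u|$ is a word $w=u^mu'$ with $u$ nonempty, $m\ge 1$ an integer and $u'$ a prefix of $u$ (a word may have several exponents). The length of the longest word of a given kind is $\infty$ if the lengths are unbounded, and $0$ if there is no such word. A factor of $\mathbf{x}$ is recurrent if it occurs infinitely often in $\mathbf{x}$. Then the following sequences (indexed by $n\ge 0$) are $(\mathbb{N}_\infty,k)$-regular: (a) the number of distinct square factors of $\mathbf{x}$ of length $n$; (b) the number of squares in $\mathbf{x}$ beginning at (centred at, ending at) position $n$; (c) the length of the longest square in $\mathbf{x}$ beginning at (centred at, ending at) position $n$; (d) the number of palindromes in $\mathbf{x}$ beginning at (centred at, ending at) position $n$; (e) the length of the longest palindrome in $\mathbf{x}$ beginning at (centred at, ending at) position $n$; (f) the length of the longest fractional power in $\mathbf{x}$ beginning at (ending at) position $n$; and likewise, for every rational number $r$, the length of the longest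 factor of $\mathbf{x}$ beginning at (ending at) position $n$ that is a fractional power with an exponent $\ge r$, respectively with an exponent $>r$; (g) the number of distinct recurrent factors of $\mathbf{x}$ of length $n$; (h) the number of distinct factors of length $n$ that occur in $\mathbf{x}$ but not in $\mathbf{y}$; (i) the number of distinct factors of length $n$ that occur in both $\mathbf{x}$ and $\mathbf{y}$. -/

import Mathlib

namespace AutoSeq

/-! ### Base-`k` words -/

/-- `[w]_k`, the integer represented in base `k` by the word `w`, most significant digit first. -/
def wordValue {k : ℕ} (w : List (Fin k)) : ℕ :=
  w.foldl (fun v d => k * v + (d : ℕ)) 0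

/-- `C_k`: the words over `{0, …, k-1}` without leading zero (the empty word represents `0`).
For `k ≥ 2` the map `wordValue` is a bijection from these words to `ℕ`. -/
def IsCanonical {k : ℕ} (w : List (Fin k)) : Prop :=
  ∀ d ∈ w.head?, (d : ℕ) ≠ 0

/-! ### Automatic sequences -/

/-- A deterministic automaton with output: input letters in `{0, …, k-1}`, states in `σ`, and an
output in `α` attached to each state. -/
structure DFAO (k : ℕ) (α : Type*) (σ : Type) where
  step : σ → Fin k → σ
  start : σ
  output : σ → α

/-- The output attached to the last state encountered when reading `w`. -/
def DFAO.run {k : ℕ} {α : Type*} {σ : Type} (M : DFAO k α σ) (w : List (Fin k)) : α :=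
  M.output (w.foldl M.step M.start)

/-- `x` is `k`-automatic: some finite automaton, on reading the base-`k` representation of `n`,
outputs `x n`. -/
def IsAutomatic {α : Type*} (k : ℕ) (x : ℕ → α) : Prop :=
  ∃ (σ : Type) (_ : Finite σ) (M : DFAO k α σ),
    ∀ w : List (Fin k), IsCanonical w → x (wordValue w) = M.run w

/-! ### Recognizable series and regular sequences -/

/-- The formal series `h : Σ* → R` is `R`-recognizable: `h w = u μ(w) v` for a row vector `u`, a
column vector `v` and a morphism `μ` from words to square matrices (determined by its values on
letters), all with entries in `R`. -/
def IsRecognizable {A : Type*} (R : Type*) [Semiring R] (h : List A → R) : Prop :=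
  ∃ (r : ℕ) (u : Fin r → R) (μ : A → Matrix (Fin r) (Fin r) R) (v : Fin r → R),
    ∀ w : List A, h w = u ⬝ᵥ ((w.map μ).prod.mulVec v)

/-- `f` is `(R, k)`-regular: the series `w ↦ f([w]_k)` over `{0, …, k-1}` is `R`-recognizable. -/
def IsRegularSeq (R : Type*) [Semiring R] (k : ℕ) (f : ℕ → R) : Prop :=
  IsRecognizable R (fun w : List (Fin k) => f (wordValue w))

/-! ### Factors -/

/-- `x[i..i+l-1]`, the factor of length `l` of `x` beginning at position `i`. -/
def factor {α : Type*} (x : ℕ → α) (i l : ℕ) : List α :=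
  (List.range l).map (fun t => x (i + t))

/-- The word `w` occurs in `x` at position `i`. -/
def OccursAt {α : Type*} (x : ℕ → α) (w : List α) (i : ℕ) : Prop :=
  factor x i w.length = w

/-- `w` is a factor of `x`. -/
def IsFactor {α : Type*} (x : ℕ → α) (w : List α) : Prop :=
  ∃ i, OccursAt x w i

/-- `w` is a recurrent factor of `x`: it occurs infinitely often. -/
def IsRecurrentFactor {α : Type*} (x : ℕ → α) (w : List α) : Prop :=
  {i | OccursAt x w i}.Infinite

/-- `w` is a (nonempty) square. -/
def IsSquareWord {α : Type*} (w : List α) : Prop :=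
  ∃ u : List α, u ≠ [] ∧ w = u ++ u

/-- `w` is a (nonempty) palindrome. -/
def IsPalindromeWord {α : Type*} (w : List α) : Prop :=
  w ≠ [] ∧ w.reverse = w

/-- `w` is a fractional power with exponent `e`: `w = uᵐ u'` with `u` nonempty, `m ≥ 1`,
`u'` a prefix of `u`, and `e = |w| / |u|`.  A word may have several exponents. -/
def HasExponent {α : Type*} (w : List α) (e : ℚ) : Prop :=
  ∃ (u u' : List α) (m : ℕ), u ≠ [] ∧ 1 ≤ m ∧ u' <+: u ∧
    w = (List.replicate m u).flatten ++ u' ∧ e = (w.length : ℚ) / (u.length : ℚ)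

/-- `w` is a fractional power (of some exponent). -/
def IsFractionalPower {α : Type*} (w : List α) : Prop :=
  ∃ e : ℚ, HasExponent w e

/-! ### Factors located at a position -/

/-- The ways in which an occurrence of a nonempty factor can be located at a position.  A factor of
even length has two middle letters, whence the two conventions `centreLeft` and `centreRight`
for its centre; `centreExact` admits only factors with one middle letter. -/
inductive Anchor where
  | start
  | centreLeft
  | centreRight
  | centreExact
  | finish

/-- The factor `x[i..i+l-1]`, where `l ≥ 1`, begins / is centred / ends at position `n`. -/
def Anchor.Locates : Anchor → (i l n : ℕ) → Prop
  | .start, i, _, n => n = i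
  | .centreLeft, i, l, n => n = i + (l - 1) / 2
  | .centreRight, i, l, n => n = i + l / 2
  | .centreExact, i, l, n => 2 * n + 1 = 2 * i + l
  | .finish, i, l, n => n + 1 = i + l

/-- The words with property `P` that occur in `x` at the position `n`, in the sense of `A`. -/
def wordsAt {α : Type*} (x : ℕ → α) (P : List α → Prop) (A : Anchor) (n : ℕ) : Set (List α) :=
  {w | P w ∧ ∃ i, OccursAt x w i ∧ A.Locates i w.length n}

/-- The length of a longest word in `S`: `∞` if the lengths are unbounded, `0` if `S = ∅`. -/
noncomputable def longest {α : Type*} (S : Set (List α)) : ℕ∞ :=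
  ⨆ w ∈ S, (w.length : ℕ∞)

end AutoSeq

open AutoSeq

/-! For a `k`-automatic sequence `x`, every relation between natural numbers that is first-order
definable from addition, order and the values of `x` is recognized by a finite automaton reading the
base-`k` digits of its arguments in parallel: affine substitutions only require bounded carries, and
a quantifier is handled by the subset construction.

If such an automaton recognizes `P n m`, then the numbers `c n s` of those `m` that lead, together
with `n`, to the state `s` satisfy a linear recurrence `c (k * n + d) = c n ᵥ* μ d`, because every
natural number is `k * m + e` for a unique `m` and a unique digit `e`. Hence `n ↦ #{m | P n m}` is a
regular sequence.

Each sequence of the theorem is such a count: words at a given position are determined by their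
lengths, distinct factors of length `n` correspond to the positions of their first occurrences, and
the supremum of a set of lengths is the number of those `m` that are less than some length. -/

namespace AutoSeq

section MultiAutomatic

variable {k n : ℕ} {ι β γ δ : Type*}

/-- The tuple obtained from `p` by appending to each entry `p i` the base-`k` digit `d i`. -/
def appendDigits (p : ι → ℕ) (d : ι → Fin k) : ι → ℕ :=
  fun i => k * p i + d i

/-- `g` is a multidimensional `k`-automatic sequence: it is computed by a finite automaton that
reads the base-`k` digits of all its arguments in parallel, most significant digits first. Here
`q p` is the state reached on reading `p`; it does not depend on the number of leading zeros. -/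
def IsMultiAutomatic (k : ℕ) (g : (ι → ℕ) → β) : Prop :=
  ∃ (σ : Type) (_ : Finite σ) (q : (ι → ℕ) → σ) (step : σ → (ι → Fin k) → σ) (out : σ → β),
    (∀ p d, q (appendDigits p d) = step (q p) d) ∧ ∀ p, g p = out (q p)

/-- `f` is an affine function of its arguments with natural number coefficients: the terms to which
automatic sequences are applied. -/
def IsAffine (f : (ι → ℕ) → ℕ) : Prop :=
  ∃ (L : (ι → ℕ) →+ ℕ) (b : ℕ), ∀ p, f p = L p + b

namespace IsAffine

theorem var (i : ι) : IsAffine (fun p : ι → ℕ => p i) :=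
  ⟨Pi.evalAddMonoidHom _ i, 0, fun _ => rfl⟩

theorem const (c : ℕ) : IsAffine (fun _ : ι → ℕ => c) :=
  ⟨0, c, fun _ => (zero_add c).symm⟩

theorem add {f g : (ι → ℕ) → ℕ} (hf : IsAffine f) (hg : IsAffine g) :
    IsAffine (fun p => f p + g p) := by
  obtain ⟨L, b, hL⟩ := hf
  obtain ⟨M, c, hM⟩ := hg
  exact ⟨L + M, b + c, fun p => by simp only [hL, hM, AddMonoidHom.add_apply]; ring⟩

theorem const_mul (c : ℕ) {f : (ι → ℕ) → ℕ} (hf : IsAffine f) : IsAffine (fun p => c * f p) := by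
  obtain ⟨L, b, hL⟩ := hf
  exact ⟨c • L, c * b, fun p => by simp only [hL, AddMonoidHom.smul_apply, smul_eq_mul]; ring⟩

theorem init {f : (Fin n → ℕ) → ℕ} (hf : IsAffine f) :
    IsAffine (fun p : Fin (n + 1) → ℕ => f (Fin.init p)) := by
  obtain ⟨L, b, hL⟩ := hf
  exact ⟨L.comp ⟨⟨Fin.init, rfl⟩, fun _ _ => rfl⟩, b, fun p => hL (Fin.init p)⟩

end IsAffine

theorem map_appendDigits (L : (ι → ℕ) →+ ℕ) (p : ι → ℕ) (d : ι → Fin k) :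
    L (appendDigits p d) = k * L p + L (fun i => (d i : ℕ)) := by
  rw [← smul_eq_mul, ← map_nsmul, ← map_add]
  rfl

theorem map_digits_add_div_le [NeZero k] {L : (ι → ℕ) →+ ℕ} {B c : ℕ} (hL : L 1 ≤ B) (hc : c ≤ B)
    (d : ι → Fin k) : (L (fun i => (d i : ℕ)) + c) / k ≤ B := by
  have hk : 1 ≤ k := NeZero.one_le
  obtain ⟨e, he⟩ : ∃ e : ι → ℕ, (k - 1) • (1 : ι → ℕ) = (fun i => (d i : ℕ)) + e :=
    exists_add_of_le fun i => by
      simpa using Nat.le_sub_one_of_lt (d i).isLt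
  have hd : L (fun i => (d i : ℕ)) ≤ (k - 1) * L 1 := by
    rw [← smul_eq_mul, ← map_nsmul, he, map_add]
    exact Nat.le_add_right _ _
  refine Nat.div_le_of_le_mul ?_
  calc L (fun i => (d i : ℕ)) + c ≤ (k - 1) * B + B := by grw [hd, hL, hc]
    _ = k * B := by rw [← Nat.succ_mul, Nat.succ_eq_add_one, Nat.sub_add_cancel hk]

theorem appendDigits_snoc (p : Fin n → ℕ) (m : ℕ) (d : Fin n → Fin k) (e : Fin k) :
    appendDigits (Fin.snoc p m : Fin (n + 1) → ℕ) (Fin.snoc d e : Fin (n + 1) → Fin k) =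
      Fin.snoc (appendDigits p d) (k * m + e) := by
  ext i
  refine Fin.lastCases ?_ (fun j => ?_) i <;> simp [appendDigits]

theorem appendDigits_pair (a b : ℕ) (d e : Fin k) :
    appendDigits ![a, b] ![d, e] = ![k * a + d, k * b + e] := by
  ext i
  fin_cases i <;> rfl

theorem mul_div_add_ofNat [NeZero k] (m : ℕ) : k * (m / k) + (Fin.ofNat k m : ℕ) = m :=
  Nat.div_add_mod m k

theorem compare_mul_add (a b : ℕ) (d e : Fin k) :
    compare (k * a + d) (k * b + e) = (compare a b).then (compare (d : ℕ) e) := by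
  have lt_of_lt {a b : ℕ} (h : a < b) (d e : Fin k) : k * a + d < k * b + e :=
    calc k * a + d < k * (a + 1) := by have := d.isLt; rw [mul_add]; omega
      _ ≤ k * b + e := (Nat.mul_le_mul_left k h).trans (Nat.le_add_right _ _)
  rcases lt_trichotomy a b with h | rfl | h
  · rw [compare_lt_iff_lt.2 h, compare_lt_iff_lt.2 (lt_of_lt h d e)]
    rfl
  · simp only [Std.compare_self, Nat.compare_eq_ite_lt, Nat.add_lt_add_iff_left, Ordering.then]
  · rw [compare_gt_iff_gt.2 h, compare_gt_iff_gt.2 (lt_of_lt h e d)]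
    rfl

namespace IsMultiAutomatic

theorem map {g : (ι → ℕ) → β} (hg : IsMultiAutomatic k g) (φ : β → γ) :
    IsMultiAutomatic k (fun p => φ (g p)) := by
  obtain ⟨σ, hσ, q, step, out, hq, hout⟩ := hg
  exact ⟨σ, hσ, q, step, φ ∘ out, hq, fun p => congrArg φ (hout p)⟩

theorem map₂ {g : (ι → ℕ) → β} {h : (ι → ℕ) → γ} (hg : IsMultiAutomatic k g)
    (hh : IsMultiAutomatic k h) (φ : β → γ → δ) : IsMultiAutomatic k (fun p => φ (g p) (h p)) := by
  obtain ⟨σ, hσ, q, step, out, hq, hout⟩ := hg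
  obtain ⟨τ, hτ, q', step', out', hq', hout'⟩ := hh
  exact ⟨σ × τ, inferInstance, fun p => (q p, q' p), fun s d => (step s.1 d, step' s.2 d),
    fun s => φ (out s.1) (out' s.2), fun p d => Prod.ext (hq p d) (hq' p d),
    fun p => congrArg₂ φ (hout p) (hout' p)⟩

section Connectives

variable {P Q : (ι → ℕ) → Prop}

theorem not (hP : IsMultiAutomatic k P) : IsMultiAutomatic k (fun p => ¬ P p) :=
  hP.map Not

theorem and (hP : IsMultiAutomatic k P) (hQ : IsMultiAutomatic k Q) :
    IsMultiAutomatic k (fun p => P p ∧ Q p) :=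
  hP.map₂ hQ And

theorem imp (hP : IsMultiAutomatic k P) (hQ : IsMultiAutomatic k Q) :
    IsMultiAutomatic k (fun p => P p → Q p) :=
  hP.map₂ hQ (· → ·)

end Connectives

section Quantifiers

variable [NeZero k] {P : (Fin n → ℕ) → ℕ → Prop}

/-- The automaton guesses the digits of the quantified variable. That variable is the last entry of
the tuple, so in nested quantifications variables are numbered from the outermost one inwards. -/
theorem exists_nat
    (hP : IsMultiAutomatic k (fun p : Fin (n + 1) → ℕ => P (Fin.init p) (p (Fin.last n)))) :
    IsMultiAutomatic k (fun p => ∃ m, P p m) := by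
  obtain ⟨σ, hσ, q, step, out, hq, hout⟩ := hP
  have hstep (p : Fin n → ℕ) (m : ℕ) (d : Fin n → Fin k) (e : Fin k) :
      q (Fin.snoc (appendDigits p d) (k * m + e)) = step (q (Fin.snoc p m)) (Fin.snoc d e) := by
    rw [← appendDigits_snoc, hq]
  have hP (p : Fin n → ℕ) (m : ℕ) : P p m ↔ out (q (Fin.snoc p m)) := by
    simpa using hout (Fin.snoc p m)
  refine ⟨Set σ, inferInstance, fun p => Set.range fun m => q (Fin.snoc p m),
    fun S d => {t | ∃ s ∈ S, ∃ e, step s (Fin.snoc d e) = t}, fun S => ∃ s ∈ S, out s,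
    fun p d => ?_, fun p => by simp [hP]⟩
  ext t
  constructor
  · rintro ⟨m, rfl⟩
    exact ⟨_, ⟨m / k, rfl⟩, Fin.ofNat k m, by rw [← hstep, mul_div_add_ofNat]⟩
  · rintro ⟨_, ⟨m, rfl⟩, e, rfl⟩
    exact ⟨k * m + e, hstep p m d e⟩

theorem forall_nat
    (hP : IsMultiAutomatic k (fun p : Fin (n + 1) → ℕ => P (Fin.init p) (p (Fin.last n)))) :
    IsMultiAutomatic k (fun p => ∀ m, P p m) := by
  simpa only [not_exists, not_not] using (exists_nat (P := fun p m => ¬ P p m) hP.not).not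

end Quantifiers

section Substitution

variable [NeZero k]

/-- If `f j = L j + b j`, the automaton for `g` is run on all tuples `L j p + c j` with bounded `c`
at the same time: reading further digits produces carries into `c`, which stay bounded. -/
theorem comp_affine {κ : Type} [Finite κ] {g : (κ → ℕ) → β} (hg : IsMultiAutomatic k g)
    {f : κ → (ι → ℕ) → ℕ} (hf : ∀ j, IsAffine (f j)) :
    IsMultiAutomatic k (fun p => g (fun j => f j p)) := by
  obtain ⟨σ, hσ, q, step, out, hq, hout⟩ := hg
  choose L b hL using hf
  obtain ⟨B, hB⟩ := (Set.finite_range fun j => L j 1 + b j).bddAbove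
  replace hB (j : κ) : L j 1 + b j ≤ B := hB ⟨j, rfl⟩
  let total (d : ι → Fin k) (c : κ → Fin (B + 1)) (j : κ) : ℕ := L j (fun i => (d i : ℕ)) + c j
  have total_div_lt (d c j) : total d c j / k < B + 1 :=
    Nat.lt_succ_of_le <| map_digits_add_div_le (by grind) (Nat.le_of_lt_succ (c j).isLt) d
  let carry (d c) (j : κ) : Fin (B + 1) := ⟨total d c j / k, total_div_lt d c j⟩
  have hcarry (p : ι → ℕ) (d c) : (fun j => L j (appendDigits p d) + c j) =
      appendDigits (fun j => L j p + carry d c j) (fun j => Fin.ofNat k (total d c j)) := by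
    funext j
    calc L j (appendDigits p d) + c j = k * L j p + total d c j := by
          rw [map_appendDigits, add_assoc]
      _ = k * (L j p + total d c j / k) + (Fin.ofNat k (total d c j) : ℕ) := by
          rw [mul_add, add_assoc, mul_div_add_ofNat]
  refine ⟨(κ → Fin (B + 1)) → σ, inferInstance, fun p c => q (fun j => L j p + c j),
    fun s d c => step (s (carry d c)) (fun j => Fin.ofNat k (total d c j)),
    fun s => out (s fun j => ⟨b j, by grind⟩), fun p d => funext fun c => ?_, fun p => ?_⟩
  · simp only [hcarry, hq]
  · simp only [hL, hout]

theorem comp_affine₂ {R : ℕ → ℕ → β}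
    (hR : IsMultiAutomatic k (fun p : Fin 2 → ℕ => R (p 0) (p 1))) {f g : (ι → ℕ) → ℕ}
    (hf : IsAffine f) (hg : IsAffine g) : IsMultiAutomatic k (fun p => R (f p) (g p)) :=
  hR.comp_affine (f := ![f, g]) (Fin.forall_fin_two.2 ⟨hf, hg⟩)

end Substitution

section Comparison

theorem compare_apply (i j : ι) : IsMultiAutomatic k (fun p : ι → ℕ => compare (p i) (p j)) :=
  ⟨Ordering, inferInstance, fun p => compare (p i) (p j),
    fun o d => o.then (compare (d i : ℕ) (d j)), id, fun _ _ => compare_mul_add _ _ _ _,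
    fun _ => rfl⟩

variable [NeZero k] {f g : (ι → ℕ) → ℕ}

theorem compare_affine (hf : IsAffine f) (hg : IsAffine g) :
    IsMultiAutomatic k (fun p => compare (f p) (g p)) :=
  (compare_apply 0 1).comp_affine₂ hf hg

theorem le (hf : IsAffine f) (hg : IsAffine g) : IsMultiAutomatic k (fun p => f p ≤ g p) := by
  simpa only [compare_le_iff_le] using (compare_affine hf hg).map (· ≠ .gt)

theorem lt (hf : IsAffine f) (hg : IsAffine g) : IsMultiAutomatic k (fun p => f p < g p) := by
  simpa only [compare_lt_iff_lt] using (compare_affine hf hg).map (· = .lt)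

theorem eq (hf : IsAffine f) (hg : IsAffine g) : IsMultiAutomatic k (fun p => f p = g p) := by
  simpa only [compare_eq_iff_eq] using (compare_affine hf hg).map (· = .eq)

end Comparison

end IsMultiAutomatic

end MultiAutomatic

section Counting

open Matrix

variable {k : ℕ}

theorem encard_eq_sum_encard_fiber {β σ : Type*} [Fintype σ] (S : Set β) (f : β → σ) :
    S.encard = ∑ s, {m ∈ S | f m = s}.encard := by
  have hdisj : Pairwise (Function.onFun Disjoint fun s => {m ∈ S | f m = s}) :=
    fun s t hst => Set.disjoint_left.2 fun m hs ht => hst (hs.2.symm.trans ht.2)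
  rw [← finsum_eq_sum_of_fintype, ← Set.encard_iUnion_of_finite hdisj]
  congr 1
  ext m
  simp

theorem encard_setOf_comp_eq_sum {β σ : Type*} [Fintype σ] (f : β → σ) (φ : σ → Prop)
    [DecidablePred φ] :
    {m | φ (f m)}.encard = ∑ s, {m | f m = s}.encard * if φ s then 1 else 0 := by
  rw [encard_eq_sum_encard_fiber _ f]
  refine Finset.sum_congr rfl fun s _ => ?_
  by_cases hs : φ s
  · rw [if_pos hs, mul_one]
    congr 1
    ext m
    exact and_iff_right_of_imp fun (h : f m = s) => (h ▸ hs : φ (f m))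
  · rw [if_neg hs, mul_zero, Set.encard_eq_zero]
    exact Set.eq_empty_of_forall_notMem fun m hm => hs (hm.2 ▸ hm.1)

theorem encard_setOf_eq_sum_digits (k : ℕ) [NeZero k] (Q : ℕ → Prop) :
    {m | Q m}.encard = ∑ e : Fin k, {m | Q (k * m + e)}.encard := by
  rw [encard_eq_sum_encard_fiber _ (Fin.ofNat k)]
  refine Finset.sum_congr rfl fun e _ => ?_
  have hinj : Function.Injective (fun m => k * m + (e : ℕ)) := fun a b hab =>
    Nat.eq_of_mul_eq_mul_left (NeZero.pos k) (Nat.add_right_cancel hab)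
  rw [← hinj.encard_image {m | Q (k * m + e)}]
  congr 1
  ext m
  constructor
  · rintro ⟨hm, rfl⟩
    exact ⟨m / k, by simpa only [Set.mem_ofPred_eq, mul_div_add_ofNat] using hm,
      mul_div_add_ofNat m⟩
  · rintro ⟨m, hm, rfl⟩
    exact ⟨hm, Fin.ext (by simp [Nat.mod_eq_of_lt])⟩

theorem wordValue_append_singleton (w : List (Fin k)) (d : Fin k) :
    wordValue (w ++ [d]) = k * wordValue w + d := by
  simp [wordValue]

theorem isRegularSeq_dotProduct_of_vecMul {R σ : Type*} [Semiring R] [Fintype σ]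
    {c : ℕ → σ → R} {μ : Fin k → Matrix σ σ R} (hc : ∀ n (d : Fin k), c (k * n + d) = c n ᵥ* μ d)
    (v : σ → R) : IsRegularSeq R k (fun n => c n ⬝ᵥ v) := by
  let ε := (Fintype.equivFin σ).symm
  have hword (w : List (Fin k)) :
      c (wordValue w) ∘ ε = (c 0 ∘ ε) ᵥ* (w.map fun d => (μ d).submatrix ε ε).prod := by
    induction w using List.reverseRecOn with
    | nil => simp [wordValue]
    | append_singleton w d ih =>
      rw [List.map_append, List.prod_append, ← vecMul_vecMul, ← ih, wordValue_append_singleton, hc]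
      simp [submatrix_vecMul_equiv, Function.comp_assoc]
  refine ⟨Fintype.card σ, c 0 ∘ ε, fun d => (μ d).submatrix ε ε, v ∘ ε, fun w => ?_⟩
  rw [dotProduct_mulVec, ← hword, comp_equiv_dotProduct_comp_equiv]

open Classical in
theorem IsMultiAutomatic.isRegularSeq_encard [NeZero k] {P : ℕ → ℕ → Prop}
    (hP : IsMultiAutomatic k (fun p : Fin 2 → ℕ => P (p 0) (p 1))) :
    IsRegularSeq ℕ∞ k (fun n => {m | P n m}.encard) := by
  obtain ⟨σ, hσ, q, step, out, hq, hout⟩ := hP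
  have := Fintype.ofFinite σ
  let c (n : ℕ) (s : σ) : ℕ∞ := {m | q ![n, m] = s}.encard
  let μ (d : Fin k) : Matrix σ σ ℕ∞ := of fun s t => ∑ e, if step s ![d, e] = t then 1 else 0
  have hrec (n : ℕ) (d : Fin k) : c (k * n + d) = c n ᵥ* μ d := by
    funext t
    calc c (k * n + d) t = ∑ e : Fin k, {m | step (q ![n, m]) ![d, e] = t}.encard := by
          simp only [c, encard_setOf_eq_sum_digits k (q ![_, ·] = t), ← appendDigits_pair, hq]
      _ = ∑ e, ∑ s, c n s * if step s ![d, e] = t then 1 else 0 :=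
          Finset.sum_congr rfl fun e _ => encard_setOf_comp_eq_sum _ (step · ![d, e] = t)
      _ = (c n ᵥ* μ d) t := by
          rw [Finset.sum_comm]
          simp only [vecMul, dotProduct, μ, of_apply, Finset.mul_sum]
  convert isRegularSeq_dotProduct_of_vecMul hrec (fun s => if out s then 1 else 0) with n
  calc {m | P n m}.encard = {m | out (q ![n, m])}.encard := by simp only [← hout]; rfl
    _ = c n ⬝ᵥ fun s => if out s then 1 else 0 := encard_setOf_comp_eq_sum _ out

end Counting

section AutomaticSequences

variable {k : ℕ}

/-- The base-`k` representation of `n` without leading zeros: the digits of `Nat.digits k n`, most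
significant digit first. -/
def canonicalWord (k n : ℕ) [NeZero k] : List (Fin k) :=
  (k.digits n).reverse.map (Fin.ofNat k)

theorem canonicalWord_zero [NeZero k] : canonicalWord k 0 = [] := by
  simp [canonicalWord]

variable [k.AtLeastTwo]

theorem canonicalWord_mul_add {m : ℕ} {d : Fin k} (h : m ≠ 0 ∨ (d : ℕ) ≠ 0) :
    canonicalWord k (k * m + d) = canonicalWord k m ++ [d] := by
  rw [canonicalWord, add_comm, Nat.digits_add k Nat.AtLeastTwo.one_lt d m d.isLt h.symm]
  simp [canonicalWord]

theorem isCanonical_canonicalWord (m : ℕ) : IsCanonical (canonicalWord k m) := by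
  intro d hd
  rw [canonicalWord, List.head?_map, List.head?_reverse, Option.mem_map] at hd
  obtain ⟨e, he, rfl⟩ := hd
  obtain ⟨hne, rfl⟩ := List.mem_getLast?_eq_getLast he
  have hm : m ≠ 0 := Nat.digits_ne_nil_iff_ne_zero.1 hne
  rw [Fin.val_ofNat, Nat.mod_eq_of_lt
    (Nat.digits_lt_base Nat.AtLeastTwo.one_lt (List.getLast_mem hne))]
  exact Nat.getLast_digit_ne_zero k hm

theorem wordValue_canonicalWord (m : ℕ) : wordValue (canonicalWord k m) = m := by
  induction m using Nat.strong_induction_on with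
  | _ m ih =>
    rcases Nat.eq_zero_or_pos m with rfl | hm
    · simp [canonicalWord_zero, wordValue]
    · have hdiv : m = k * (m / k) + (Fin.ofNat k m : ℕ) := (mul_div_add_ofNat m).symm
      have hne : m / k ≠ 0 ∨ (Fin.ofNat k m : ℕ) ≠ 0 := by
        by_contra! h
        rw [h.1, h.2] at hdiv
        omega
      conv_lhs => rw [hdiv]
      rw [canonicalWord_mul_add hne, wordValue_append_singleton,
        ih _ (Nat.div_lt_self hm Nat.AtLeastTwo.one_lt), ← hdiv]

theorem IsAutomatic.isMultiAutomatic {α : Type*} {x : ℕ → α} (hx : IsAutomatic k x) :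
    IsMultiAutomatic k (fun p : Fin 1 → ℕ => x (p 0)) := by
  classical
  obtain ⟨σ, hσ, M, hM⟩ := hx
  let q (m : ℕ) : σ × Prop := ((canonicalWord k m).foldl M.step M.start, m = 0)
  -- `M` need not ignore leading zeros, so nothing is fed to it while the number read is still `0`.
  let step (s : σ × Prop) (d : Fin k) : σ × Prop :=
    if s.2 ∧ (d : ℕ) = 0 then s else (M.step s.1 d, False)
  have hq (m : ℕ) (d : Fin k) : q (k * m + d) = step (q m) d := by
    by_cases h : m = 0 ∧ (d : ℕ) = 0
    · rw [h.1, h.2, mul_zero, add_zero]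
      exact (if_pos ⟨rfl, h.2⟩).symm
    · have hne : k * m + (d : ℕ) ≠ 0 := by simpa [NeZero.ne k] using h
      simp only [q, step, if_neg h, canonicalWord_mul_add (not_and_or.1 h), List.foldl_append,
        List.foldl_cons, List.foldl_nil, hne]
  refine ⟨σ × Prop, inferInstance, fun p => q (p 0), fun s d => step s (d 0),
    fun s => M.output s.1, fun p d => hq (p 0) (d 0), fun p => ?_⟩
  calc x (p 0) = x (wordValue (canonicalWord k (p 0))) := by rw [wordValue_canonicalWord]
    _ = M.run (canonicalWord k (p 0)) := hM _ (isCanonical_canonicalWord _)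

theorem IsAutomatic.comp_affine {α ι : Type*} {x : ℕ → α} (hx : IsAutomatic k x)
    {f : (ι → ℕ) → ℕ} (hf : IsAffine f) : IsMultiAutomatic k (fun p => x (f p)) :=
  hx.isMultiAutomatic.comp_affine (f := fun _ => f) fun _ => hf

end AutomaticSequences

section Factors

variable {α : Type*} {x y : ℕ → α} {i j l : ℕ}

@[simp]
theorem length_factor (x : ℕ → α) (i l : ℕ) : (factor x i l).length = l := by
  simp [factor]

@[simp]
theorem getElem_factor (x : ℕ → α) (i l t : ℕ) (h : t < (factor x i l).length) :
    (factor x i l)[t] = x (i + t) := by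
  simp [factor]

theorem factor_eq_factor_iff :
    factor x i l = factor y j l ↔ ∀ t, t < l → x (i + t) = y (j + t) := by
  simp [factor]

theorem factor_add (x : ℕ → α) (i a b : ℕ) :
    factor x i (a + b) = factor x i a ++ factor x (i + a) b := by
  simp [factor, List.range_add, add_assoc]

theorem isFactor_factor_iff : IsFactor y (factor x i l) ↔ ∃ j, factor y j l = factor x i l := by
  simp only [IsFactor, OccursAt, length_factor]

theorem isRecurrentFactor_factor_iff :
    IsRecurrentFactor y (factor x i l) ↔ ∀ N, ∃ j, N ≤ j ∧ factor y j l = factor x i l := by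
  simp only [IsRecurrentFactor, ← Nat.frequently_atTop_iff_infinite, Filter.frequently_atTop,
    OccursAt, length_factor]

theorem IsRecurrentFactor.isFactor {w : List α} (h : IsRecurrentFactor x w) : IsFactor x w :=
  h.nonempty

theorem isSquareWord_factor_iff :
    IsSquareWord (factor x i l) ↔ ∃ m, 1 ≤ m ∧ l = 2 * m ∧ factor x i m = factor x (i + m) m := by
  constructor
  · rintro ⟨u, hu, h⟩
    obtain rfl : l = u.length + u.length := by simpa using congrArg List.length h
    rw [factor_add] at h
    obtain ⟨hleft, hright⟩ := List.append_inj h (length_factor ..)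
    exact ⟨u.length, List.length_pos_iff.2 hu, (two_mul _).symm, hleft.trans hright.symm⟩
  · rintro ⟨m, hm, rfl, h⟩
    refine ⟨factor x i m, ?_, by rw [two_mul, factor_add, ← h]⟩
    rwa [← List.length_pos_iff, length_factor]

theorem isPalindromeWord_factor_iff :
    IsPalindromeWord (factor x i l) ↔
      1 ≤ l ∧ ∀ s t, s + t + 1 = l → x (i + s) = x (i + t) := by
  have hrev (t : ℕ) (ht : t < l) :
      (factor x i l).reverse[t]'(by simpa using ht) = x (i + (l - 1 - t)) := by
    rw [List.getElem_reverse, getElem_factor, length_factor]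
  rw [IsPalindromeWord, ← List.length_pos_iff, length_factor]
  refine and_congr_right fun _ => ⟨fun h s t hst => ?_, fun h => ?_⟩
  · have ht : t < (factor x i l).reverse.length := by
      rw [List.length_reverse, length_factor]
      omega
    calc x (i + s) = (factor x i l).reverse[t] := by
          rw [hrev t (by omega), show l - 1 - t = s by omega]
      _ = x (i + t) := by simp only [h, getElem_factor]
  · refine List.ext_getElem (by simp) fun t _ ht => ?_
    rw [length_factor] at ht
    rw [hrev t ht, getElem_factor, h (l - 1 - t) t (by omega)]

theorem exists_eq_flatten_replicate_append_of_hasPeriod {w : List α} {p : ℕ} (hp : 1 ≤ p)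
    (hpw : p ≤ w.length) (h : w.HasPeriod p) :
    ∃ (m : ℕ) (u : List α), 1 ≤ m ∧ u <+: w.take p ∧
      w = (List.replicate m (w.take p)).flatten ++ u := by
  induction hl : w.length using Nat.strong_induction_on generalizing w with
  | _ l ih =>
    have hdrop : w.drop p <+: w := h.drop_prefix
    rcases Nat.lt_or_ge (w.drop p).length p with hlt | hge
    · exact ⟨1, w.drop p, le_rfl, List.prefix_take_iff.2 ⟨hdrop, hlt.le⟩, by simp⟩
    · have htake : (w.drop p).take p = w.take p := by
        obtain ⟨s, hs⟩ := hdrop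
        conv_rhs => rw [← hs, List.take_append_of_le_length hge]
      obtain ⟨m, u, hm, hu, hw⟩ := ih (w.drop p).length (by rw [List.length_drop]; omega)
        hge (h.infix hdrop.isInfix) rfl
      rw [htake] at hu hw
      refine ⟨m + 1, u, by omega, hu, ?_⟩
      rw [List.replicate_succ, List.flatten_cons, List.append_assoc, ← hw, List.take_append_drop]

theorem hasPeriod_flatten_replicate_append {u v : List α} (m : ℕ) (hv : v <+: u) :
    ((List.replicate (m + 1) u).flatten ++ v).HasPeriod u.length := by
  have hcomm : u ++ (List.replicate m u).flatten = (List.replicate m u).flatten ++ u := by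
    rw [← List.flatten_cons, ← List.replicate_succ, List.replicate_succ', List.flatten_append,
      List.flatten_singleton]
  rw [List.HasPeriod, List.replicate_succ, List.flatten_cons, List.append_assoc, List.take_left,
    List.prefix_append_right_inj, ← List.append_assoc u, hcomm, List.append_assoc,
    List.prefix_append_right_inj]
  exact hv.trans (List.prefix_append u v)

theorem exists_hasExponent_iff {w : List α} {Q : ℚ → Prop} :
    (∃ e, Q e ∧ HasExponent w e) ↔
      ∃ p : ℕ, (1 ≤ p ∧ Q (w.length / p)) ∧ p ≤ w.length ∧ w.HasPeriod p := by
  constructor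
  · rintro ⟨_, hQ, u, v, m, hu, hm, hv, rfl, rfl⟩
    obtain ⟨m, rfl⟩ := Nat.exists_eq_add_of_le' hm
    refine ⟨u.length, ⟨List.length_pos_iff.2 hu, hQ⟩, ?_, hasPeriod_flatten_replicate_append m hv⟩
    rw [List.replicate_succ, List.flatten_cons, List.append_assoc, List.length_append]
    exact Nat.le_add_right _ _
  · rintro ⟨p, ⟨hp, hQ⟩, hpw, hper⟩
    obtain ⟨m, v, hm, hv, hw⟩ := exists_eq_flatten_replicate_append_of_hasPeriod hp hpw hper
    have hlen : (w.take p).length = p := by simpa using hpw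
    refine ⟨_, hQ, w.take p, v, m, ?_, hm, hv, hw, by rw [hlen]⟩
    rwa [← List.length_pos_iff, hlen]

theorem hasPeriod_factor_iff {p : ℕ} :
    (factor x i l).HasPeriod p ↔ ∀ t, t + p < l → x (i + t) = x (i + (t + p)) := by
  rw [List.hasPeriod_iff_getElem?, length_factor]
  refine forall_congr' fun t => ?_
  rw [Nat.lt_sub_iff_add_lt]
  refine imp_congr_right fun ht => ?_
  rw [List.getElem?_eq_getElem (by simp; omega), List.getElem?_eq_getElem (by simpa)]
  simp

end Factors

section Positions

variable {α : Type*} {x : ℕ → α} {P : List α → Prop} {A : Anchor} {n : ℕ}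

theorem Anchor.Locates.unique {i j l : ℕ} (hi : A.Locates i l n) (hj : A.Locates j l n) :
    i = j := by
  cases A <;> simp only [Anchor.Locates] at hi hj <;> omega

theorem Anchor.locates_centreLeft_iff {i l : ℕ} :
    Anchor.centreLeft.Locates i l n ↔
      (i ≤ n ∧ 2 * i + l ≤ 2 * n + 2) ∧ (i < n → 2 * n + 1 ≤ 2 * i + l) := by
  simp only [Anchor.Locates]
  omega

theorem Anchor.locates_centreRight_iff {i l : ℕ} :
    Anchor.centreRight.Locates i l n ↔ 2 * n ≤ 2 * i + l ∧ 2 * i + l ≤ 2 * n + 1 := by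
  simp only [Anchor.Locates]
  omega

theorem image_length_wordsAt :
    List.length '' wordsAt x P A n = {l | ∃ i, A.Locates i l n ∧ P (factor x i l)} := by
  ext l
  constructor
  · rintro ⟨w, ⟨hP, i, hw, hA⟩, rfl⟩
    exact ⟨i, hA, by rwa [hw]⟩
  · rintro ⟨i, hA, hP⟩
    exact ⟨factor x i l, ⟨hP, i, by rw [OccursAt, length_factor], by rwa [length_factor]⟩,
      length_factor x i l⟩

theorem injOn_length_wordsAt : Set.InjOn List.length (wordsAt x P A n) := by
  rintro w ⟨-, i, hw, hA⟩ w' ⟨-, j, hw', hA'⟩ h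
  rw [OccursAt] at hw hw'
  rw [← h] at hw' hA'
  rw [← hw, ← hw', hA.unique hA']

theorem encard_wordsAt :
    (wordsAt x P A n).encard = {l | ∃ i, A.Locates i l n ∧ P (factor x i l)}.encard := by
  rw [← injOn_length_wordsAt.encard_image, image_length_wordsAt]

theorem iSup_natCast_eq_encard (L : Set ℕ) :
    ⨆ l ∈ L, (l : ℕ∞) = {m | ∃ l ∈ L, m < l}.encard := by
  have encard_Iio (N : ℕ) : (Set.Iio N).encard = N := by
    rw [← Finset.coe_Iio, Set.encard_coe_eq_coe_finsetCard, Nat.card_Iio]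
  apply le_antisymm
  · refine iSup₂_le fun l hl => ?_
    rw [← encard_Iio l]
    exact Set.encard_le_encard fun m hm => ⟨l, hl, hm⟩
  · induction hN : ⨆ l ∈ L, (l : ℕ∞) using ENat.recTopCoe with
    | top => exact le_top
    | coe N =>
      rw [← encard_Iio N]
      refine Set.encard_le_encard fun m ⟨l, hl, hm⟩ => hm.trans_le ?_
      have hlN : (l : ℕ∞) ≤ N := hN ▸ le_iSup₂ (f := fun (l : ℕ) (_ : l ∈ L) => (l : ℕ∞)) l hl
      exact_mod_cast hlN

theorem longest_wordsAt :
    longest (wordsAt x P A n) =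
      {m | ∃ l, (∃ i, A.Locates i l n ∧ P (factor x i l)) ∧ m < l}.encard := by
  rw [longest, ← iSup_image (f := List.length) (g := fun l : ℕ => (l : ℕ∞)), image_length_wordsAt,
    iSup_natCast_eq_encard]
  rfl

theorem encard_factors :
    {w | IsFactor x w ∧ P w ∧ w.length = n}.encard =
      {i | P (factor x i n) ∧ ∀ j, j < i → ¬ factor x j n = factor x i n}.encard := by
  classical
  have hinj : Set.InjOn (fun i => factor x i n)
      {i | P (factor x i n) ∧ ∀ j, j < i → ¬ factor x j n = factor x i n} := by
    rintro i ⟨-, hi⟩ j ⟨-, hj⟩ h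
    exact le_antisymm (not_lt.1 fun hji => hi j hji h.symm) (not_lt.1 fun hij => hj i hij h)
  rw [← hinj.encard_image]
  congr 1
  ext w
  constructor
  · rintro ⟨h : ∃ i, factor x i w.length = w, hP, rfl⟩
    refine ⟨Nat.find h, ⟨?_, fun j hj => ?_⟩, Nat.find_spec h⟩
    · rwa [Nat.find_spec h]
    · rw [Nat.find_spec h]
      exact Nat.find_min h hj
  · rintro ⟨i, ⟨hP, -⟩, rfl⟩
    exact ⟨isFactor_factor_iff.2 ⟨i, rfl⟩, hP, length_factor x i n⟩

end Positions

section Definability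

variable {α : Type*} {k n : ℕ} {x y : ℕ → α}

/-- The pairs `(i, l)` for which the factor of `x` of length `l` beginning at position `i` has
property `P` are recognized by an automaton. -/
def HasAutomaticOccurrences (k : ℕ) (x : ℕ → α) (P : List α → Prop) : Prop :=
  IsMultiAutomatic k (fun p : Fin 2 → ℕ => P (factor x (p 0) (p 1)))

theorem HasAutomaticOccurrences.not {P : List α → Prop} (hP : HasAutomaticOccurrences k x P) :
    HasAutomaticOccurrences k x (fun w => ¬ P w) :=
  IsMultiAutomatic.not hP

theorem HasAutomaticOccurrences.comp_affine [NeZero k] {P : List α → Prop}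
    (hP : HasAutomaticOccurrences k x P) {ι : Type*} {i l : (ι → ℕ) → ℕ} (hi : IsAffine i)
    (hl : IsAffine l) : IsMultiAutomatic k (fun p => P (factor x (i p) (l p))) :=
  hP.comp_affine₂ (R := fun i l => P (factor x i l)) hi hl

theorem IsMultiAutomatic.locates [NeZero k] (A : Anchor) {ι : Type*} {i l m : (ι → ℕ) → ℕ}
    (hi : IsAffine i) (hl : IsAffine l) (hm : IsAffine m) :
    IsMultiAutomatic k (fun p => A.Locates (i p) (l p) (m p)) := by
  have hil : IsAffine (fun p => 2 * i p + l p) := (hi.const_mul 2).add hl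
  have hm_add (c : ℕ) : IsAffine (fun p => 2 * m p + c) := (hm.const_mul 2).add (.const c)
  cases A with
  | start => exact eq hm hi
  | finish => exact eq (hm.add (.const 1)) (hi.add hl)
  | centreExact => exact eq (hm_add 1) hil
  | centreLeft =>
    simp only [Anchor.locates_centreLeft_iff]
    exact ((le hi hm).and (le hil (hm_add 2))).and ((lt hi hm).imp (le (hm_add 1) hil))
  | centreRight =>
    simp only [Anchor.locates_centreRight_iff]
    exact (le (hm.const_mul 2) hil).and (le hil (hm_add 1))

theorem exists_forall_le_div_iff_and_lt_div_iff (r : ℚ) :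
    ∃ a b c : ℕ, ∀ l p : ℕ, 1 ≤ p →
      (r ≤ l / p ↔ a * p ≤ c * l + b * p) ∧ (r < l / p ↔ a * p < c * l + b * p) := by
  have hr : r = ((r.num.toNat : ℚ) - (-r.num).toNat) / r.den := by
    have hnum : ((r.num.toNat : ℤ) : ℚ) - ((-r.num).toNat : ℤ) = r.num := by
      exact_mod_cast Int.toNat_sub_toNat_neg r.num
    rw [← Int.cast_natCast, ← Int.cast_natCast (-r.num).toNat, hnum, Rat.num_div_den]
  refine ⟨r.num.toNat, (-r.num).toNat, r.den, fun l p hp => ?_⟩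
  have hp' : (0 : ℚ) < p := by exact_mod_cast hp
  have hden : (0 : ℚ) < r.den := by exact_mod_cast r.den_pos
  generalize r.num.toNat = a, (-r.num).toNat = b, r.den = c at hr hden
  rw [hr, div_le_div_iff₀ hden hp', div_lt_div_iff₀ hden hp', sub_mul, sub_le_iff_le_add,
    sub_lt_iff_lt_add, mul_comm (l : ℚ)]
  norm_cast

namespace IsAutomatic

open IsMultiAutomatic

variable [k.AtLeastTwo]

theorem factor_eq_factor (hx : IsAutomatic k x) (hy : IsAutomatic k y) {i j l : (Fin n → ℕ) → ℕ}
    (hi : IsAffine i) (hj : IsAffine j) (hl : IsAffine l) :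
    IsMultiAutomatic k (fun p => factor x (i p) (l p) = factor y (j p) (l p)) := by
  simp only [factor_eq_factor_iff]
  exact forall_nat ((lt (.var (Fin.last n)) hl.init).imp
    ((hx.comp_affine (hi.init.add (.var (Fin.last n)))).map₂
      (hy.comp_affine (hj.init.add (.var (Fin.last n)))) Eq))

theorem hasAutomaticOccurrences_isSquareWord (hx : IsAutomatic k x) :
    HasAutomaticOccurrences k x IsSquareWord := by
  simp only [HasAutomaticOccurrences, isSquareWord_factor_iff]
  exact exists_nat <| (le (.const 1) (.var 2)).and <| (eq (.var 1) (.const_mul 2 (.var 2))).and <|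
    factor_eq_factor hx hx (.var 0) (.add (.var 0) (.var 2)) (.var 2)

theorem hasAutomaticOccurrences_isPalindromeWord (hx : IsAutomatic k x) :
    HasAutomaticOccurrences k x IsPalindromeWord := by
  simp only [HasAutomaticOccurrences, isPalindromeWord_factor_iff]
  exact (le (.const 1) (.var 1)).and <| forall_nat <| forall_nat <|
    (eq (.add (.add (.var 2) (.var 3)) (.const 1)) (.var 1)).imp <|
      (hx.comp_affine (.add (.var 0) (.var 2))).map₂ (hx.comp_affine (.add (.var 0) (.var 3))) Eq

theorem isMultiAutomatic_hasPeriod_factor (hx : IsAutomatic k x) :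
    IsMultiAutomatic k (fun p : Fin 3 → ℕ => (factor x (p 0) (p 1)).HasPeriod (p 2)) := by
  simp only [hasPeriod_factor_iff]
  exact forall_nat <| (lt (.add (.var 3) (.var 2)) (.var 1)).imp <|
    (hx.comp_affine (.add (.var 0) (.var 3))).map₂
      (hx.comp_affine (.add (.var 0) (.add (.var 3) (.var 2)))) Eq

theorem hasAutomaticOccurrences_exists_hasExponent (hx : IsAutomatic k x) {Q : ℚ → Prop}
    (hQ : IsMultiAutomatic k (fun p : Fin 2 → ℕ => 1 ≤ p 1 ∧ Q (p 0 / p 1))) :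
    HasAutomaticOccurrences k x (fun w => ∃ e, Q e ∧ HasExponent w e) := by
  simp only [HasAutomaticOccurrences, exists_hasExponent_iff, length_factor]
  exact exists_nat <| (hQ.comp_affine₂ (R := fun l p => 1 ≤ p ∧ Q (l / p)) (.var 1) (.var 2)).and <|
    (le (.var 2) (.var 1)).and hx.isMultiAutomatic_hasPeriod_factor

theorem hasAutomaticOccurrences_isFractionalPower (hx : IsAutomatic k x) :
    HasAutomaticOccurrences k x IsFractionalPower := by
  have h := hx.hasAutomaticOccurrences_exists_hasExponent (Q := fun _ => True)
    (by simpa only [and_true] using le (.const 1) (.var 1))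
  simp only [true_and] at h
  exact h

theorem hasAutomaticOccurrences_exists_le_hasExponent (hx : IsAutomatic k x) (r : ℚ) :
    HasAutomaticOccurrences k x (fun w => ∃ e, r ≤ e ∧ HasExponent w e) := by
  obtain ⟨a, b, c, h⟩ := exists_forall_le_div_iff_and_lt_div_iff r
  refine hx.hasAutomaticOccurrences_exists_hasExponent ?_
  simp only [and_congr_right fun hp => (h _ _ hp).1]
  exact (le (.const 1) (.var 1)).and
    (le (.const_mul a (.var 1)) (.add (.const_mul c (.var 0)) (.const_mul b (.var 1))))

theorem hasAutomaticOccurrences_exists_lt_hasExponent (hx : IsAutomatic k x) (r : ℚ) :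
    HasAutomaticOccurrences k x (fun w => ∃ e, r < e ∧ HasExponent w e) := by
  obtain ⟨a, b, c, h⟩ := exists_forall_le_div_iff_and_lt_div_iff r
  refine hx.hasAutomaticOccurrences_exists_hasExponent ?_
  simp only [and_congr_right fun hp => (h _ _ hp).2]
  exact (le (.const 1) (.var 1)).and
    (lt (.const_mul a (.var 1)) (.add (.const_mul c (.var 0)) (.const_mul b (.var 1))))

theorem hasAutomaticOccurrences_isFactor (hx : IsAutomatic k x) (hy : IsAutomatic k y) :
    HasAutomaticOccurrences k x (IsFactor y) := by
  simp only [HasAutomaticOccurrences, isFactor_factor_iff]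
  exact exists_nat (factor_eq_factor hy hx (.var 2) (.var 0) (.var 1))

theorem hasAutomaticOccurrences_isRecurrentFactor (hx : IsAutomatic k x) (hy : IsAutomatic k y) :
    HasAutomaticOccurrences k x (IsRecurrentFactor y) := by
  simp only [HasAutomaticOccurrences, isRecurrentFactor_factor_iff]
  exact forall_nat <| exists_nat <| (le (.var 2) (.var 3)).and <|
    factor_eq_factor hy hx (.var 3) (.var 0) (.var 1)

end IsAutomatic

section Regularity

open IsMultiAutomatic

variable {P : List α → Prop}

theorem isRegularSeq_encard_wordsAt [NeZero k] (hP : HasAutomaticOccurrences k x P) (A : Anchor) :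
    IsRegularSeq ℕ∞ k (fun n => (wordsAt x P A n).encard) := by
  simp only [encard_wordsAt]
  refine isRegularSeq_encard (P := fun n l => ∃ i, A.Locates i l n ∧ P (factor x i l)) ?_
  exact exists_nat <| (locates A (.var 2) (.var 1) (.var 0)).and (hP.comp_affine (.var 2) (.var 1))

theorem isRegularSeq_longest_wordsAt [NeZero k] (hP : HasAutomaticOccurrences k x P) (A : Anchor) :
    IsRegularSeq ℕ∞ k (fun n => longest (wordsAt x P A n)) := by
  simp only [longest_wordsAt]
  refine isRegularSeq_encard
    (P := fun n m => ∃ l, (∃ i, A.Locates i l n ∧ P (factor x i l)) ∧ m < l) ?_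
  exact exists_nat <| .and (exists_nat <| (locates A (.var 3) (.var 2) (.var 0)).and
    (hP.comp_affine (.var 3) (.var 2))) (lt (.var 1) (.var 2))

theorem isRegularSeq_encard_factors [k.AtLeastTwo] (hx : IsAutomatic k x)
    (hP : HasAutomaticOccurrences k x P) :
    IsRegularSeq ℕ∞ k (fun n => {w | IsFactor x w ∧ P w ∧ w.length = n}.encard) := by
  simp only [encard_factors]
  refine isRegularSeq_encard
    (P := fun n i => P (factor x i n) ∧ ∀ j, j < i → ¬ factor x j n = factor x i n) ?_
  exact (hP.comp_affine (.var 1) (.var 0)).and <| forall_nat <| (lt (.var 2) (.var 1)).imp <|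
    (hx.factor_eq_factor hx (.var 2) (.var 1) (.var 0)).not

end Regularity

end Definability

end AutoSeq

theorem mainTheorem9_general {α : Type*} (k : ℕ) (hk : 2 ≤ k) (x y : ℕ → α)
    (hx : IsAutomatic k x) (hy : IsAutomatic k y) :
    IsRegularSeq ℕ∞ k (fun n => {w | IsFactor x w ∧ w.length = n ∧ IsSquareWord w}.encard) ∧
    (∀ A : Anchor, IsRegularSeq ℕ∞ k (fun n => (wordsAt x IsSquareWord A n).encard)) ∧
    (∀ A : Anchor, IsRegularSeq ℕ∞ k (fun n => longest (wordsAt x IsSquareWord A n))) ∧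
    (∀ A : Anchor, IsRegularSeq ℕ∞ k (fun n => (wordsAt x IsPalindromeWord A n).encard)) ∧
    (∀ A : Anchor, IsRegularSeq ℕ∞ k (fun n => longest (wordsAt x IsPalindromeWord A n))) ∧
    (∀ A : Anchor,
      IsRegularSeq ℕ∞ k (fun n => longest (wordsAt x IsFractionalPower A n)) ∧
      ∀ r : ℚ,
        IsRegularSeq ℕ∞ k
          (fun n => longest (wordsAt x (fun w => ∃ e, r ≤ e ∧ HasExponent w e) A n)) ∧
        IsRegularSeq ℕ∞ k
          (fun n => longest (wordsAt x (fun w => ∃ e, r < e ∧ HasExponent w e) A n))) ∧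
    IsRegularSeq ℕ∞ k (fun n => {w | IsRecurrentFactor x w ∧ w.length = n}.encard) ∧
    IsRegularSeq ℕ∞ k (fun n => {w | IsFactor x w ∧ ¬ IsFactor y w ∧ w.length = n}.encard) ∧
    IsRegularSeq ℕ∞ k (fun n => {w | IsFactor x w ∧ IsFactor y w ∧ w.length = n}.encard) := by
  have : k.AtLeastTwo := ⟨hk⟩
  have hsq := hx.hasAutomaticOccurrences_isSquareWord
  have hpal := hx.hasAutomaticOccurrences_isPalindromeWord
  have hfrac := hx.hasAutomaticOccurrences_isFractionalPower
  have hrec := hx.hasAutomaticOccurrences_isRecurrentFactor hx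
  have hfac := hx.hasAutomaticOccurrences_isFactor hy
  refine ⟨?_, isRegularSeq_encard_wordsAt hsq, isRegularSeq_longest_wordsAt hsq,
    isRegularSeq_encard_wordsAt hpal, isRegularSeq_longest_wordsAt hpal,
    fun A => ⟨isRegularSeq_longest_wordsAt hfrac A, fun r => ⟨?_, ?_⟩⟩, ?_,
    isRegularSeq_encard_factors hx hfac.not, isRegularSeq_encard_factors hx hfac⟩
  · simpa only [and_comm (b := IsSquareWord _)] using isRegularSeq_encard_factors hx hsq
  · exact isRegularSeq_longest_wordsAt (hx.hasAutomaticOccurrences_exists_le_hasExponent r) A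
  · exact isRegularSeq_longest_wordsAt (hx.hasAutomaticOccurrences_exists_lt_hasExponent r) A
  · simpa only [← and_assoc, and_iff_right_of_imp IsRecurrentFactor.isFactor] using
      isRegularSeq_encard_factors hx hrec

theorem mainTheorem9 {α : Type*} (k : ℕ) (hk : 2 ≤ k) (x y : ℕ → α)
    (hx : IsAutomatic k x) (hy : IsAutomatic k y) :
    -- (a) distinct square factors of length `n`
    IsRegularSeq ℕ∞ k (fun n => {w | IsFactor x w ∧ w.length = n ∧ IsSquareWord w}.encard) ∧
    -- (b) number of squares beginning / centred / ending at `n`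
    (∀ A : Anchor, IsRegularSeq ℕ∞ k (fun n => (wordsAt x IsSquareWord A n).encard)) ∧
    -- (c) length of the longest square beginning / centred / ending at `n`
    (∀ A : Anchor, IsRegularSeq ℕ∞ k (fun n => longest (wordsAt x IsSquareWord A n))) ∧
    -- (d) number of palindromes beginning / centred / ending at `n`
    (∀ A : Anchor, IsRegularSeq ℕ∞ k (fun n => (wordsAt x IsPalindromeWord A n).encard)) ∧
    -- (e) length of the longest palindrome beginning / centred / ending at `n`
    (∀ A : Anchor, IsRegularSeq ℕ∞ k (fun n => longest (wordsAt x IsPalindromeWord A n))) ∧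
    -- (f) length of the longest fractional power beginning / ending at `n`, without restriction
    -- on the exponent, and with exponent at least, or greater than, a given rational number
    (∀ A : Anchor, A = .start ∨ A = .finish →
      IsRegularSeq ℕ∞ k (fun n => longest (wordsAt x IsFractionalPower A n)) ∧
      ∀ r : ℚ,
        IsRegularSeq ℕ∞ k (fun n => longest (wordsAt x (fun w => ∃ e, r ≤ e ∧ HasExponent w e) A n)) ∧
        IsRegularSeq ℕ∞ k
          (fun n => longest (wordsAt x (fun w => ∃ e, r < e ∧ HasExponent w e) A n))) ∧
    -- (g) distinct recurrent factors of length `n`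
    IsRegularSeq ℕ∞ k (fun n => {w | IsRecurrentFactor x w ∧ w.length = n}.encard) ∧
    -- (h) factors of length `n` that occur in `x` but not in `y`
    IsRegularSeq ℕ∞ k (fun n => {w | IsFactor x w ∧ ¬ IsFactor y w ∧ w.length = n}.encard) ∧
    -- (i) factors of length `n` that occur in both `x` and `y`
    IsRegularSeq ℕ∞ k (fun n => {w | IsFactor x w ∧ IsFactor y w ∧ w.length = n}.encard) :=
  let ⟨ha, hb, hc, hd, he, hf, hghi⟩ := mainTheorem9_general k hk x y hx hy
  ⟨ha, hb, hc, hd, he, fun A _ => hf A, hghi⟩
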